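/- Fix $N$ modes. Let $\Omega=\bigoplus_{k=1}^{N}\begin{pmatrix}0&1\\-1&0\end{pmatrix}$. A real $2N\times2N$ matrix $S$ is symplectic if $S\Omega S^{T}=\Omega$. A covariance matrix is a (symmetric) positive definite real $2N\times 2N$ matrix $\Gamma$ with $\Gamma+\tfrac{i}{2}\Omega\ge 0$. It is free if $\Gamma=O\bigl(\bigoplus_{k}\nu_k\mathbb I_2\bigr)O^{T}$ for some orthogonal symplectic $O$ and some $\nu_k\ge \tfrac12$. The symplectic eigenvalues of a positive definite $\Gamma$ are the numbers $\nu_1,\dots,\nu_N>0$ in a Williamson normal form $\Gamma=S\bigl(\bigoplus_k\nu_k\mathbb I_2\bigr)S^{T}$ with $S$ symplectic, and the symplectic trace is $\mathrm{Str}[\Gamma]=2\sum_{k}\nu_k$. The local extractable work of a covariance matrix $\Gamma$ is $$\mathcal W_l(\Gamma)=\tfrac12\max_{O,\,r}\ \mathrm{Tr}\bigl[\Gamma-Z_r\,O\,\Gamma\,O^{T}Z_r\bigr],\qquad Z_r=\bigoplus_{k=1}^{N}\begin{pmatrix}e^{r_k}&0\\0&e^{-r_k}\end{pmatrix},$$ where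 $O$ runs over the orthogonal symplectic matrices and $r$ over $\mathbb R^{N}$. Then: 1. Every positive definite $\Gamma$ has a Williamson normal form and $\mathrm{Str}[\Gamma]$ does not depend on its choice. For positive definite $C$ and $D$, $$\mathrm{Str}[C+D]\ \ge\ \mathrm{Str}[C]+\mathrm{Str}[D].$$ 2. For every covariance matrix $\Gamma$ the maximum that defines $\mathcal W_l(\Gamma)$ is attained, and $\mathcal W_l(\Gamma)=\tfrac12\bigl(\mathrm{Tr}[\Gamma]-\mathrm{Str}[\Gamma]\bigr)$. 3. $\mathcal W_l$ is a convex function on the convex set of covariance matrices: if $\Gamma^{(1)},\dots,\Gamma^{(m)}$ are covariance matrices, $p_j\ge0$ and $\sum_{j}p_j=1$, then $\sum_j p_j\Gamma^{(j)}$ is a covariance matrix and $$\mathcal W_l\Bigl(\sum_{j=1}^{m}p_j\Gamma^{(j)}\Bigr)\ \le\ \sum_{j=1}^{m}p_j\,\mathcal W_l\bigl(\Gamma^{(j)}\bigr).$$ 4. If moreover all the $\Gamma^{(j)}$ are free, then $\mathcal W_l\bigl(\sum_j p_j\Gamma^{(j)}\bigr)=0$, and $\sum_j p_j\Gamma^{(j)}$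 is again a free covariance matrix. -/

import Mathlib

open scoped ComplexOrder

namespace GaussianWork

/-- Real `2N × 2N` matrices on the phase space of `N` modes. The index `(0, k)` is the position
quadrature of mode `k` and `(1, k)` is its momentum quadrature. -/
abbrev PhaseMatrix (N : ℕ) : Type := Matrix (Fin 2 × Fin N) (Fin 2 × Fin N) ℝ

/-- The symplectic form `Ω`, the direct sum over the modes of `ω = (0, 1; -1, 0)`. -/
def Omega (N : ℕ) : PhaseMatrix N :=
  Matrix.blockDiagonal fun _ : Fin N => !![0, 1; -1, 0]

/-- `S` is symplectic: `S Ω Sᵀ = Ω`. -/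
def IsSymplectic {N : ℕ} (S : PhaseMatrix N) : Prop :=
  S * Omega N * S.transpose = Omega N

/-- Orthogonal symplectic matrices: the phase-space action of linear interferometers (passive
Gaussian unitaries). -/
def IsPassive {N : ℕ} (O : PhaseMatrix N) : Prop :=
  O * O.transpose = 1 ∧ IsSymplectic O

/-- The direct sum of the single-mode matrices `ν k • 1`. For `ν k ≥ 1 / 2` it is the covariance
matrix of a product of thermal states with mean photon numbers `ν k - 1 / 2`. -/
def thermal {N : ℕ} (ν : Fin N → ℝ) : PhaseMatrix N :=
  Matrix.blockDiagonal fun k => ν k • (1 : Matrix (Fin 2) (Fin 2) ℝ)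

/-- The direct sum of the single-mode squeezers `diag (e ^ r k, e ^ (- r k))`. -/
noncomputable def squeezer {N : ℕ} (r : Fin N → ℝ) : PhaseMatrix N :=
  Matrix.blockDiagonal fun k => !![Real.exp (r k), 0; 0, Real.exp (-r k)]

/-- Covariance matrices (with `ħ = 1`): positive definite real matrices that satisfy the uncertainty
relation `Γ + (i / 2) Ω ≥ 0`. -/
def IsCovariance {N : ℕ} (Γ : PhaseMatrix N) : Prop :=
  Γ.PosDef ∧
    (Γ.map (fun x : ℝ => (x : ℂ)) +
      (Complex.I / 2) • (Omega N).map (fun x : ℝ => (x : ℂ))).PosSemidef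

/-- Free covariance matrices: those of products of thermal states acted upon by a passive
Gaussian unitary. -/
def IsFreeCovariance {N : ℕ} (Γ : PhaseMatrix N) : Prop :=
  ∃ (O : PhaseMatrix N) (ν : Fin N → ℝ),
    IsPassive O ∧ (∀ k, 1 / 2 ≤ ν k) ∧ Γ = O * thermal ν * O.transpose

/-- `ν` lists the symplectic eigenvalues of `Γ`: it is the diagonal of a Williamson normal form
`Γ = S (⨁ ν k • 1) Sᵀ`, with `S` symplectic and all `ν k` positive. -/
def IsSymplecticSpectrum {N : ℕ} (Γ : PhaseMatrix N) (ν : Fin N → ℝ) : Prop :=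
  (∀ k, 0 < ν k) ∧ ∃ S : PhaseMatrix N, IsSymplectic S ∧ Γ = S * thermal ν * S.transpose

open Classical in
/-- The symplectic eigenvalues of `Γ`, in some order (and `0` if there is no Williamson normal
form, which does not happen for a positive definite `Γ`). -/
noncomputable def symplecticEigenvalues {N : ℕ} (Γ : PhaseMatrix N) : Fin N → ℝ :=
  if h : ∃ ν, IsSymplecticSpectrum Γ ν then h.choose else 0

/-- The symplectic trace: twice the sum of the symplectic eigenvalues. -/
noncomputable def Str {N : ℕ} (Γ : PhaseMatrix N) : ℝ :=
  2 * ∑ k, symplecticEigenvalues Γ k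

/-- The work extracted from `Γ` by the interferometer `O` followed by the squeezers with
parameters `r`: the decrease of the energy, which is half the trace of the covariance matrix. -/
noncomputable def extractedWork {N : ℕ} (Γ O : PhaseMatrix N) (r : Fin N → ℝ) : ℝ :=
  1 / 2 * (Γ - squeezer r * (O * Γ * O.transpose) * squeezer r).trace

/-- All the amounts of work that can be extracted from `Γ` by single-mode squeezers assisted with
a global linear interferometer. -/
def workValues {N : ℕ} (Γ : PhaseMatrix N) : Set ℝ :=
  {w | ∃ (O : PhaseMatrix N) (r : Fin N → ℝ), IsPassive O ∧ w = extractedWork Γ O r}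

/-- The local Gaussian extractable work assisted with linear interferometers. -/
noncomputable def localWork {N : ℕ} (Γ : PhaseMatrix N) : ℝ :=
  sSup (workValues Γ)

end GaussianWork

open GaussianWork

/-! Everything follows from the variational formula `Str Γ` = min of Tr[S Γ Sᵀ] over symplectic S.
In Williamson form the lower bound is AM-GM on pairs of columns of S
(`IsSymplectic.two_mul_sum_le_trace`), and undoing the Williamson matrix attains it. A minimum of
functionals linear in Γ is independent of the normal form, superadditive and concave.

The trace sees S only through Sᵀ S = Oᵀ Z_r² O (`IsSymplectic.exists_euler`), so interferometers and
squeezers already reach this minimum. Hence the work is ½(Tr − Str), a linear function minus a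
concave one.

Free matrices are exactly the covariance matrices commuting with Ω, a linear condition that mixtures
preserve; for them the passive normal form is a Williamson form, so Tr = Str.

Both the Williamson and the Euler decompositions come from the single spectral lemma below, with
different choices of `K` and `P`. -/

/-- A skew-adjoint injective operator `K` and a symmetric operator `P` whose eigenvectors are
permuted by `K` and are eigenvectors of `K ^ 2` have a common normal form: there is an orthonormal
family of `2 * n` eigenvectors of `P`, grouped in pairs that `K` rotates. -/
theorem exists_orthonormal_paired_eigenvectors {E : Type*} [NormedAddCommGroup E]
    [InnerProductSpace ℝ E] [FiniteDimensional ℝ E] {K P : E →ₗ[ℝ] E}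
    (hK : ∀ x y, inner ℝ (K x) y = -inner ℝ x (K y)) (hK0 : ∀ x, K x = 0 → x = 0)
    (hP : P.IsSymmetric)
    (hPK : ∀ (v : E) (c : ℝ), P v = c • v → ∃ d : ℝ, P (K v) = d • K v)
    (hKK : ∀ (v : E) (c : ℝ), P v = c • v → ∃ d : ℝ, K (K v) = d • v)
    (n : ℕ) (hn : 2 * n ≤ Module.finrank ℝ E) :
    ∃ (u : Fin 2 × Fin n → E) (a : Fin 2 × Fin n → ℝ) (κ : Fin n → ℝ),
      Orthonormal ℝ u ∧ (∀ i, P (u i) = a i • u i) ∧ (∀ k, 0 < κ k) ∧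
        (∀ k, K (u (0, k)) = -(κ k) • u (1, k)) ∧ ∀ k, K (u (1, k)) = κ k • u (0, k) := by
  induction n with
  | zero =>
    exact ⟨fun i => i.2.elim0, fun i => i.2.elim0, fun k => k.elim0,
      ⟨fun i => i.2.elim0, fun i => i.2.elim0⟩, fun i => i.2.elim0, fun k => k.elim0,
      fun k => k.elim0, fun k => k.elim0⟩
  | succ n ih =>
    obtain ⟨u, a, κ, hu, ha, hκ, h0, h1⟩ := ih (by omega)
    have hmem : ∀ x, x ∈ (Submodule.span ℝ (Set.range u))ᗮ ↔ ∀ i, inner ℝ (u i) x = 0 := by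
      intro x
      rw [Submodule.mem_orthogonal]
      refine ⟨fun h i => h _ (Submodule.subset_span ⟨i, rfl⟩), fun h y hy => ?_⟩
      induction hy using Submodule.span_induction with
      | mem y hy => obtain ⟨i, rfl⟩ := hy; exact h i
      | zero => simp
      | add y z _ _ hy hz => rw [inner_add_left, hy, hz, add_zero]
      | smul c y _ hy => rw [inner_smul_left, hy, mul_zero]
    set W := (Submodule.span ℝ (Set.range u))ᗮ with hW
    have hPW : ∀ x ∈ W, P x ∈ W := by
      intro x hx
      rw [hmem] at hx ⊢
      intro i
      rw [← hP, ha, inner_smul_left, hx, mul_zero]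
    have hKW : ∀ x ∈ W, K x ∈ W := by
      intro x hx
      rw [hmem] at hx ⊢
      rintro ⟨i, k⟩
      have := hK (u (i, k)) x
      fin_cases i
      · simp only [Fin.zero_eta] at this ⊢
        rw [h0, inner_smul_left, hx] at this
        linarith
      · simp only [Fin.mk_one] at this ⊢
        rw [h1, inner_smul_left, hx] at this
        linarith
    -- The span has dimension at most 2n, while the space has dimension at least 2n + 2.
    have hWne : Nontrivial W := by
      have e1 := (Submodule.span ℝ (Set.range u)).finrank_add_finrank_orthogonal
      have e2 := finrank_range_le_card (R := ℝ) u
      simp only [Set.finrank, Fintype.card_prod, Fintype.card_fin] at e2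
      rw [← hW] at e1
      exact Module.nontrivial_of_finrank_pos (R := ℝ) (by omega)
    obtain ⟨b, hb⟩ : ∃ b : ℝ, Module.End.HasEigenvalue (P.restrict hPW) b :=
      ⟨_, (hP.restrict_invariant hPW).hasEigenvalue_iSup_of_finiteDimensional⟩
    obtain ⟨x, hx⟩ := hb.exists_hasEigenvector
    obtain ⟨v, hvW, hvb, hv1⟩ : ∃ v ∈ W, P v = b • v ∧ ‖v‖ = 1 := by
      refine ⟨‖(x : E)‖⁻¹ • (x : E), W.smul_mem _ x.2, ?_, ?_⟩
      · have := congrArg Subtype.val hx.apply_eq_smul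
        rw [LinearMap.coe_restrict_apply] at this
        rw [map_smul, this]
        exact smul_comm _ _ _
      · have : (x : E) ≠ 0 := fun h => hx.2 (Subtype.ext h)
        rw [norm_smul, norm_inv, norm_norm, inv_mul_cancel₀ (norm_ne_zero_iff.2 this)]
    have hKv : 0 < ‖K v‖ := by
      rw [norm_pos_iff]
      intro h
      rw [hK0 v h] at hv1
      simp at hv1
    set c := ‖K v‖ with hc
    have hvv : inner ℝ v v = (1 : ℝ) := by rw [real_inner_self_eq_norm_sq, hv1]; norm_num
    have hKvv : inner ℝ v (K v) = (0 : ℝ) := by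
      have := hK v v
      rw [real_inner_comm] at this
      linarith
    obtain ⟨d, hd⟩ := hPK v b hvb
    obtain ⟨t, ht⟩ := hKK v b hvb
    -- Skewness gives ⟨Kv, Kv⟩ = -⟨v, K²v⟩ = -t.
    have htc : t = -c ^ 2 := by
      have := hK v (K v)
      rw [ht, inner_smul_right, hvv, real_inner_self_eq_norm_sq, ← hc] at this
      linarith
    -- The sign matches the columns of Ω: K sends the first vector to -c times the second, and the
    -- second to c times the first.
    set w : Fin 2 → E := ![v, -c⁻¹ • K v] with hw
    have hwW : ∀ i, w i ∈ W := by
      intro i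
      fin_cases i
      · exact hvW
      · exact W.smul_mem _ (hKW v hvW)
    have hwo : ∀ i j, inner ℝ (w i) (w j) = if i = j then (1 : ℝ) else 0 := by
      intro i j
      have hKvv' : inner ℝ (K v) v = (0 : ℝ) := by rw [real_inner_comm, hKvv]
      fin_cases i <;> fin_cases j <;>
        simp [hw, inner_smul_left, inner_smul_right, hKvv, hKvv', hv1, norm_smul, ← hc]
      left
      rw [abs_of_pos hKv, inv_mul_cancel₀ hKv.ne']
    refine ⟨fun i => Fin.snoc (α := fun _ => E) (fun k => u (i.1, k)) (w i.1) i.2,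
      fun i => Fin.snoc (α := fun _ => ℝ) (fun k => a (i.1, k)) (![b, d] i.1) i.2,
      Fin.snoc (α := fun _ => ℝ) κ c, ?_, ?_, ?_, ?_, ?_⟩
    · rw [orthonormal_iff_ite] at hu ⊢
      rintro ⟨i, k⟩ ⟨j, l⟩
      have e1 := fun i k j => (hmem _).1 (hwW j) (i, k)
      induction k using Fin.lastCases with
      | last =>
        induction l using Fin.lastCases with
        | last => simp [hwo]
        | cast l => simp [real_inner_comm, e1, (Fin.castSucc_lt_last _).ne']
      | cast k =>
        induction l using Fin.lastCases with
        | last => simp [e1, (Fin.castSucc_lt_last _).ne]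
        | cast l => simp [hu]
    · rintro ⟨i, k⟩
      induction k using Fin.lastCases with
      | last =>
        fin_cases i
        · simpa [hw] using hvb
        · simp only [Fin.mk_one, hw, Fin.snoc_last, Matrix.cons_val_one, Matrix.cons_val_zero,
            map_smul, hd]
          exact smul_comm _ _ _
      | cast k => simp [ha]
    · intro k
      induction k using Fin.lastCases with
      | last => simpa using hKv
      | cast k => simp [hκ]
    · intro k
      induction k using Fin.lastCases with
      | last => simp [hw, smul_smul, hKv.ne']
      | cast k => simp [h0]
    · intro k
      induction k using Fin.lastCases with
      | last =>
        have : -c⁻¹ * -c ^ 2 = c := by field_simp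
        simp only [hw, Fin.snoc_last, Matrix.cons_val_one, Matrix.cons_val_zero, map_smul, ht, htc,
          smul_smul, this]
      | cast k => simp [h1]

namespace GaussianWork

open Matrix

variable {N : ℕ}

/-! ### Algebra of Ω, thermal matrices, squeezers and the symplectic group. -/

theorem thermal_eq_diagonal (ν : Fin N → ℝ) : thermal ν = diagonal fun i => ν i.2 := by
  ext ⟨i, k⟩ ⟨j, l⟩
  simp only [thermal, blockDiagonal_apply, diagonal_apply, Matrix.smul_apply, one_apply, Prod.mk.injEq,
    smul_eq_mul]
  split_ifs <;> simp_all

theorem squeezer_eq_diagonal (r : Fin N → ℝ) :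
    squeezer r = diagonal fun i => Real.exp (![r i.2, -r i.2] i.1) := by
  ext ⟨i, k⟩ ⟨j, l⟩
  fin_cases i <;> fin_cases j <;>
    simp [squeezer, blockDiagonal_apply, diagonal_apply]

theorem Omega_transpose : (Omega N)ᵀ = -Omega N := by
  ext ⟨i, k⟩ ⟨j, l⟩
  fin_cases i <;> fin_cases j <;>
    simp only [Omega, transpose_apply, Matrix.neg_apply, blockDiagonal_apply, eq_comm (a := l)] <;>
    split_ifs <;> simp

theorem Omega_mul_self : Omega N * Omega N = -1 := by
  have : (-1 : PhaseMatrix N) = blockDiagonal fun _ => -1 := by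
    rw [← blockDiagonal_one, ← blockDiagonal_neg]
    rfl
  rw [this, Omega, ← blockDiagonal_mul]
  congr 1
  ext k i j
  fin_cases i <;> fin_cases j <;> simp

theorem thermal_mul (ν μ : Fin N → ℝ) : thermal ν * thermal μ = thermal (ν * μ) := by
  simp [thermal_eq_diagonal]

theorem thermal_one : thermal (1 : Fin N → ℝ) = 1 := by
  simp [thermal_eq_diagonal]

theorem thermal_transpose (ν : Fin N → ℝ) : (thermal ν)ᵀ = thermal ν := by
  simp [thermal_eq_diagonal]

theorem Omega_mul_thermal (ν : Fin N → ℝ) : Omega N * thermal ν = thermal ν * Omega N := by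
  simp only [Omega, thermal, ← blockDiagonal_mul]
  simp

theorem mulVec_Omega_zero (v : Fin 2 × Fin N → ℝ) (k : Fin N) :
    (Omega N *ᵥ v) (0, k) = v (1, k) := by
  simp [Omega, mulVec, dotProduct, Fintype.sum_prod_type, blockDiagonal_apply]

theorem mulVec_Omega_one (v : Fin 2 × Fin N → ℝ) (k : Fin N) :
    (Omega N *ᵥ v) (1, k) = -v (0, k) := by
  simp [Omega, mulVec, dotProduct, Fintype.sum_prod_type, blockDiagonal_apply]

theorem IsSymplectic.mul {S T : PhaseMatrix N} (hS : IsSymplectic S) (hT : IsSymplectic T) :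
    IsSymplectic (S * T) := by
  unfold IsSymplectic at *
  rw [transpose_mul, show S * T * Omega N * (Tᵀ * Sᵀ) = S * (T * Omega N * Tᵀ) * Sᵀ by
    simp only [Matrix.mul_assoc], hT, hS]

/-- Since Ω² = -1, the matrix -Ω Sᵀ Ω is a right inverse of S, hence a left inverse, which is the
transposed relation. -/
theorem IsSymplectic.transpose {S : PhaseMatrix N} (hS : IsSymplectic S) : IsSymplectic Sᵀ := by
  unfold IsSymplectic at *
  have h : S * (-(Omega N * Sᵀ * Omega N)) = 1 := by
    rw [Matrix.mul_neg, ← Matrix.mul_assoc, ← Matrix.mul_assoc, hS, Omega_mul_self, neg_neg]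
  rw [mul_eq_one_comm] at h
  rw [transpose_transpose]
  calc Sᵀ * Omega N * S = -(Omega N * Omega N) * (Sᵀ * Omega N * S) := by
        rw [Omega_mul_self, neg_neg, Matrix.one_mul]
    _ = Omega N * (-(Omega N * Sᵀ * Omega N) * S) := by
        simp only [Matrix.mul_assoc, Matrix.neg_mul, Matrix.mul_neg]
    _ = Omega N := by rw [h, Matrix.mul_one]

theorem IsSymplectic.exists_left_inverse {S : PhaseMatrix N} (hS : IsSymplectic S) :
    ∃ T, IsSymplectic T ∧ T * S = 1 := by
  have h : S * (-(Omega N * Sᵀ * Omega N)) = 1 := by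
    rw [Matrix.mul_neg, ← Matrix.mul_assoc, ← Matrix.mul_assoc, hS, Omega_mul_self, neg_neg]
  have h' := mul_eq_one_comm.1 h
  refine ⟨_, ?_, h'⟩
  set T := -(Omega N * Sᵀ * Omega N)
  have ht : Sᵀ * Tᵀ = 1 := by rw [← transpose_mul, h', transpose_one]
  unfold IsSymplectic at *
  calc T * Omega N * Tᵀ = T * (S * Omega N * Sᵀ) * Tᵀ := by rw [hS]
    _ = (T * S) * Omega N * (Sᵀ * Tᵀ) := by simp only [Matrix.mul_assoc]
    _ = Omega N := by rw [h', ht, Matrix.one_mul, Matrix.mul_one]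

theorem IsPassive.transpose_mul_self {O : PhaseMatrix N} (hO : IsPassive O) : Oᵀ * O = 1 :=
  mul_eq_one_comm.1 hO.1

theorem IsPassive.transpose {O : PhaseMatrix N} (hO : IsPassive O) : IsPassive Oᵀ :=
  ⟨by rw [transpose_transpose, hO.transpose_mul_self], hO.2.transpose⟩

theorem IsPassive.mul_Omega {O : PhaseMatrix N} (hO : IsPassive O) :
    O * Omega N = Omega N * O := by
  have h := hO.2
  unfold IsSymplectic at h
  calc O * Omega N = O * Omega N * (Oᵀ * O) := by rw [hO.transpose_mul_self, Matrix.mul_one]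
    _ = (O * Omega N * Oᵀ) * O := by simp only [Matrix.mul_assoc]
    _ = Omega N * O := by rw [h]

theorem squeezer_transpose (r : Fin N → ℝ) : (squeezer r)ᵀ = squeezer r := by
  simp [squeezer_eq_diagonal]

theorem isSymplectic_squeezer (r : Fin N → ℝ) : IsSymplectic (squeezer r) := by
  unfold IsSymplectic
  rw [squeezer_transpose]
  simp only [Omega, squeezer, ← blockDiagonal_mul]
  congr 1
  ext k i j
  fin_cases i <;> fin_cases j <;> simp [← Real.exp_add]

/-! ### Normal forms: passive diagonalization, Euler, Williamson. -/

/-- A skew-symmetric invertible matrix and a compatible symmetric matrix have a common orthogonal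
normal form. -/
theorem exists_orthogonal_normal_form {K P : PhaseMatrix N} (hK : Kᵀ = -K)
    (hK0 : ∀ v, K *ᵥ v = 0 → v = 0) (hP : Pᵀ = P)
    (hPK : ∀ (v : Fin 2 × Fin N → ℝ) (c : ℝ), P *ᵥ v = c • v →
      ∃ d : ℝ, P *ᵥ (K *ᵥ v) = d • K *ᵥ v)
    (hKK : ∀ (v : Fin 2 × Fin N → ℝ) (c : ℝ), P *ᵥ v = c • v →
      ∃ d : ℝ, K *ᵥ (K *ᵥ v) = d • v) :
    ∃ (Q : PhaseMatrix N) (a : Fin 2 × Fin N → ℝ) (κ : Fin N → ℝ),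
      Q * Qᵀ = 1 ∧ P * Q = Q * diagonal a ∧ (∀ k, 0 < κ k) ∧
        K * Q = Q * (thermal κ * Omega N) := by
  obtain ⟨u, a, κ, hu, ha, hκ, h0, h1⟩ := exists_orthonormal_paired_eigenvectors
    (E := EuclideanSpace ℝ (Fin 2 × Fin N)) (K := toEuclideanLin K) (P := toEuclideanLin P)
    (fun x y => by
      simp only [toLpLin_apply, EuclideanSpace.inner_eq_star_dotProduct, star_trivial]
      rw [dotProduct_comm (K *ᵥ y.ofLp), dotProduct_mulVec, ← mulVec_transpose, hK, neg_mulVec,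
        neg_dotProduct, dotProduct_comm])
    (fun x hx => by
      rw [toLpLin_apply] at hx
      have := hK0 x.ofLp (by simpa using congrArg WithLp.ofLp hx)
      ext i
      simpa using congrFun this i)
    (isSymmetric_toEuclideanLin_iff.2 (by rw [IsHermitian, conjTranspose_eq_transpose_of_trivial, hP]))
    (fun v c h => by
      obtain ⟨d, hd⟩ := hPK v.ofLp c (by simpa [toLpLin_apply] using congrArg WithLp.ofLp h)
      exact ⟨d, by simp [toLpLin_apply, hd]⟩)
    (fun v c h => by
      obtain ⟨d, hd⟩ := hKK v.ofLp c (by simpa [toLpLin_apply] using congrArg WithLp.ofLp h)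
      exact ⟨d, by simp [toLpLin_apply, hd]⟩)
    N (by simp)
  refine ⟨of fun i j => u j i, a, κ, ?_, ?_, hκ, ?_⟩
  · rw [mul_eq_one_comm]
    ext i j
    rw [orthonormal_iff_ite] at hu
    have := hu i j
    rw [EuclideanSpace.inner_eq_star_dotProduct, dotProduct_comm] at this
    rw [one_apply, ← this]
    rfl
  · ext i j
    have := congrArg (fun x => x.ofLp i) (ha j)
    simp only [toLpLin_apply] at this
    rw [mul_diagonal]
    simpa [mulVec, dotProduct, mul_apply, mul_comm] using this
  · ext i ⟨j, k⟩
    have e0 := congrArg (fun x => x.ofLp i) (h0 k)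
    have e1 := congrArg (fun x => x.ofLp i) (h1 k)
    simp only [toLpLin_apply] at e0 e1
    fin_cases j
    · simpa [mulVec, dotProduct, mul_apply, Omega, thermal_eq_diagonal, Fintype.sum_prod_type,
        blockDiagonal_apply, diagonal_apply, mul_comm] using e0
    · simpa [mulVec, dotProduct, mul_apply, Omega, thermal_eq_diagonal, Fintype.sum_prod_type,
        blockDiagonal_apply, diagonal_apply, mul_comm] using e1

theorem Omega_mulVec_eq_zero {v : Fin 2 × Fin N → ℝ} (h : Omega N *ᵥ v = 0) : v = 0 := by
  have : Omega N *ᵥ (Omega N *ᵥ v) = -v := by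
    rw [mulVec_mulVec, Omega_mul_self, neg_mulVec, one_mulVec]
  rw [h, mulVec_zero] at this
  exact neg_eq_zero.1 this.symm

/-- A symmetric matrix whose eigenvectors are permuted by `Ω` is diagonalized by an orthogonal
symplectic matrix. -/
theorem exists_passive_diagonalization {P : PhaseMatrix N} (hP : Pᵀ = P)
    (h : ∀ (v : Fin 2 × Fin N → ℝ) (c : ℝ), P *ᵥ v = c • v →
      ∃ d : ℝ, P *ᵥ (Omega N *ᵥ v) = d • Omega N *ᵥ v) :
    ∃ (O : PhaseMatrix N) (a : Fin 2 × Fin N → ℝ), IsPassive O ∧ P = O * diagonal a * Oᵀ := by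
  obtain ⟨Q, a, κ, hQ, hPQ, hκ, hΩ⟩ := exists_orthogonal_normal_form Omega_transpose
    (fun v => Omega_mulVec_eq_zero) hP h
    (fun v c _ => ⟨-1, by rw [mulVec_mulVec, Omega_mul_self, neg_mulVec, one_mulVec, neg_one_smul]⟩)
  have hQ' : Qᵀ * Q = 1 := mul_eq_one_comm.1 hQ
  -- Ω² = -1 forces κ² = 1, so κ = 1 by positivity; then Q commutes with Ω and is symplectic.
  have e : Q * (-thermal (κ * κ)) = -Q := by
    calc Q * (-thermal (κ * κ)) = Q * (thermal κ * (Omega N * thermal κ) * Omega N) := by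
          rw [Omega_mul_thermal, ← thermal_mul]
          simp only [Matrix.mul_assoc, Omega_mul_self, Matrix.mul_neg, Matrix.mul_one]
      _ = Q * (thermal κ * Omega N) * (thermal κ * Omega N) := by simp only [Matrix.mul_assoc]
      _ = Omega N * (Q * (thermal κ * Omega N)) := by rw [← hΩ, Matrix.mul_assoc, ← hΩ]
      _ = -Q := by rw [← hΩ, ← Matrix.mul_assoc, Omega_mul_self, Matrix.neg_mul, Matrix.one_mul]
  have e2 : thermal (κ * κ) = 1 := by
    have := congrArg (Qᵀ * ·) e
    simpa only [← Matrix.mul_assoc, hQ', Matrix.one_mul, Matrix.mul_neg, neg_inj] using this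
  have hκ1 : κ = 1 := by
    ext k
    have := congrFun (congrFun e2 (0, k)) (0, k)
    simp only [thermal_eq_diagonal, diagonal_apply_eq, Pi.mul_apply, one_apply_eq] at this
    have := hκ k
    simp only [Pi.one_apply]
    nlinarith
  refine ⟨Q, a, ⟨hQ, ?_⟩, ?_⟩
  · rw [hκ1, thermal_one, Matrix.one_mul] at hΩ
    rw [IsSymplectic, ← hΩ, Matrix.mul_assoc, hQ, Matrix.mul_one]
  · rw [← hPQ, Matrix.mul_assoc, hQ, Matrix.mul_one]

/-- The part of the Euler (Bloch–Messiah) decomposition that determines `Sᵀ S`. -/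
theorem IsSymplectic.exists_euler {S : PhaseMatrix N} (hS : IsSymplectic S) :
    ∃ (O : PhaseMatrix N) (r : Fin N → ℝ), IsPassive O ∧
      Sᵀ * S = Oᵀ * (squeezer r * squeezer r) * O := by
  have hST := hS.transpose
  have hΩ : (Sᵀ * S) * Omega N * (Sᵀ * S) = Omega N := by
    have h1 : S * Omega N * Sᵀ = Omega N := hS
    have h2 : Sᵀ * Omega N * S = Omega N := by simpa [IsSymplectic] using hST
    calc (Sᵀ * S) * Omega N * (Sᵀ * S) = Sᵀ * (S * Omega N * Sᵀ) * S := by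
          simp only [Matrix.mul_assoc]
      _ = Omega N := by rw [h1, h2]
  obtain ⟨O, a, hO, ha⟩ := exists_passive_diagonalization (P := Sᵀ * S) (by simp) (by
    intro v c hv
    -- With M = Sᵀ S, the relation M Ω M = Ω turns an eigenvector v for c into an eigenvector Ωv for
    -- c⁻¹.
    have e : Omega N *ᵥ v = c • (Sᵀ * S) *ᵥ (Omega N *ᵥ v) := by
      conv_lhs => rw [← hΩ]
      rw [← mulVec_mulVec, hv, mulVec_smul, mulVec_mulVec]
    rcases eq_or_ne c 0 with rfl | hc
    · rw [zero_smul] at e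
      exact ⟨0, by rw [e, mulVec_zero, smul_zero]⟩
    · exact ⟨c⁻¹, by conv_rhs => rw [e, smul_smul, inv_mul_cancel₀ hc, one_smul]⟩)
  have hD : diagonal a = (S * O)ᵀ * (S * O) := by
    calc diagonal a = (Oᵀ * O) * diagonal a * (Oᵀ * O) := by
          rw [hO.transpose_mul_self, Matrix.one_mul, Matrix.mul_one]
      _ = Oᵀ * (O * diagonal a * Oᵀ) * O := by simp only [Matrix.mul_assoc]
      _ = (S * O)ᵀ * (S * O) := by rw [← ha, transpose_mul]; simp only [Matrix.mul_assoc]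
  have hDΩ : diagonal a * Omega N * diagonal a = Omega N := by
    have h1 := (hS.mul hO.2)
    have h2 := h1.transpose
    rw [IsSymplectic] at h1 h2
    rw [transpose_transpose] at h2
    rw [hD]
    calc (S * O)ᵀ * (S * O) * Omega N * ((S * O)ᵀ * (S * O))
          = (S * O)ᵀ * ((S * O) * Omega N * (S * O)ᵀ) * (S * O) := by
          simp only [Matrix.mul_assoc]
      _ = Omega N := by rw [h1, h2]
  have ha1 : ∀ k, a (0, k) * a (1, k) = 1 := by
    intro k
    have := congrFun (congrFun hDΩ (0, k)) (1, k)
    simpa [mul_diagonal, diagonal_mul, Omega] using this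
  have ha0 : ∀ i, 0 ≤ a i := by
    intro i
    have := congrFun (congrFun hD i) i
    rw [diagonal_apply_eq, mul_apply] at this
    rw [this]
    exact Finset.sum_nonneg fun j _ => mul_self_nonneg _
  -- Each pair of eigenvalues has product 1, so it reads (e^{2r}, e^{-2r}).
  refine ⟨Oᵀ, fun k => Real.log (a (0, k)) / 2, hO.transpose, ?_⟩
  rw [transpose_transpose, ha]
  congr 2
  rw [squeezer_eq_diagonal, diagonal_mul_diagonal]
  congr 1
  ext ⟨i, k⟩
  have hpos : 0 < a (0, k) :=
    (ha0 _).lt_of_ne fun h0 => by have := ha1 k; rw [← h0] at this; simp at this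
  rw [← Real.exp_add]
  fin_cases i
  · simp [Real.exp_log hpos]
  · simp only [Fin.mk_one, cons_val_one, cons_val_fin_one]
    rw [← neg_add, add_halves, Real.exp_neg, Real.exp_log hpos]
    exact eq_inv_of_mul_eq_one_right (ha1 k)

/-- Williamson's theorem. -/
theorem exists_isSymplecticSpectrum {Γ : PhaseMatrix N} (hΓ : Γ.PosDef) :
    ∃ ν, IsSymplecticSpectrum Γ ν := by
  obtain ⟨B, hB⟩ : ∃ B : PhaseMatrix N, Γ = Bᵀ * B := by
    open scoped MatrixOrder in
    exact CStarAlgebra.nonneg_iff_eq_star_mul_self.mp hΓ.posSemidef.nonneg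
  have hBu : IsUnit B := by
    have := hΓ.isUnit
    rw [hB] at this
    exact isUnit_of_mul_isUnit_right this
  obtain ⟨C, hCB⟩ : ∃ C, C * B = 1 := hBu.exists_left_inv
  have hBC : B * C = 1 := mul_eq_one_comm.1 hCB
  -- With Γ = Bᵀ B, bringing K to the form Q (κ Ω) Qᵀ yields S = Bᵀ Q κ^{-1/2}. The choice P = K²
  -- makes the compatibility conditions automatic.
  set K := B * Omega N * Bᵀ with hKdef
  have hK : Kᵀ = -K := by
    rw [hKdef, transpose_mul, transpose_mul, transpose_transpose, Omega_transpose, Matrix.neg_mul,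
      Matrix.mul_neg, Matrix.mul_assoc]
  have hKi : -(Cᵀ * Omega N * C) * K = 1 := by
    calc -(Cᵀ * Omega N * C) * K = -(Cᵀ * Omega N * (C * B) * Omega N * Bᵀ) := by
          simp only [hKdef, Matrix.mul_assoc, Matrix.neg_mul]
      _ = Cᵀ * Bᵀ := by
          rw [hCB, Matrix.mul_one, Matrix.mul_assoc Cᵀ, Omega_mul_self]; simp
      _ = 1 := by rw [← transpose_mul, hBC, transpose_one]
  obtain ⟨Q, a, κ, hQ, -, hκ, hKQ⟩ := exists_orthogonal_normal_form (K := K) (P := K * K) hK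
    (fun v hv => by
      have := congrArg (fun M => M *ᵥ v) hKi
      simp only [← mulVec_mulVec, hv, mulVec_zero, one_mulVec] at this
      exact this.symm)
    (by rw [transpose_mul, hK, neg_mul_neg])
    (fun v c h => ⟨c, by
      rw [← mulVec_smul, ← h]; simp only [mulVec_mulVec, Matrix.mul_assoc]⟩)
    (fun v c h => ⟨c, by rw [← h, mulVec_mulVec]⟩)
  have hQ' : Qᵀ * Q = 1 := mul_eq_one_comm.1 hQ
  have hinv : κ⁻¹ * κ = 1 := by ext k; simp [(hκ k).ne']
  set μ : Fin N → ℝ := fun k => (Real.sqrt (κ k))⁻¹ with hμ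
  have hμμ : μ * μ = κ⁻¹ := by
    ext k
    simp only [hμ, Pi.mul_apply, Pi.inv_apply]
    rw [← mul_inv, Real.mul_self_sqrt (hκ k).le]
  refine ⟨κ, hκ, Bᵀ * Q * thermal μ, ?_, ?_⟩
  -- A is -K⁻¹, and S Ω Sᵀ = Bᵀ A B = -Ω⁻¹ = Ω.
  · set A := Q * (thermal κ⁻¹ * Omega N) * Qᵀ with hA
    have hAK : K * A = -1 := by
      calc K * A = (K * Q) * (thermal κ⁻¹ * Omega N) * Qᵀ := by
            simp only [hA, Matrix.mul_assoc]
        _ = Q * (thermal κ * (Omega N * thermal κ⁻¹) * Omega N) * Qᵀ := by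
            rw [hKQ]; simp only [Matrix.mul_assoc]
        _ = Q * (thermal (κ⁻¹ * κ) * (Omega N * Omega N)) * Qᵀ := by
            rw [Omega_mul_thermal, mul_comm κ⁻¹, ← thermal_mul]; simp only [Matrix.mul_assoc]
        _ = -1 := by rw [hinv, thermal_one, Omega_mul_self]; simp [hQ]
    have h1 : (-(A * B * Omega N)) * Bᵀ = 1 := by
      rw [← neg_eq_iff_eq_neg, ← Matrix.neg_mul, mul_eq_one_comm] at hAK
      rw [← hAK, hKdef]
      simp only [Matrix.mul_assoc, Matrix.neg_mul, Matrix.mul_neg]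
    rw [mul_eq_one_comm] at h1
    unfold IsSymplectic
    calc Bᵀ * Q * thermal μ * Omega N * (Bᵀ * Q * thermal μ)ᵀ
        = Bᵀ * (Q * (thermal μ * (Omega N * thermal μ)) * Qᵀ) * B := by
          simp only [transpose_mul, transpose_transpose, thermal_transpose, Matrix.mul_assoc]
      _ = Bᵀ * A * B := by
          rw [Omega_mul_thermal, ← Matrix.mul_assoc (thermal μ), thermal_mul, hμμ]
      _ = (Bᵀ * -(A * B * Omega N)) * Omega N := by
          simp only [Matrix.mul_assoc, Matrix.neg_mul, Matrix.mul_neg, Omega_mul_self, neg_neg,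
            Matrix.mul_one]
      _ = Omega N := by rw [h1, Matrix.one_mul]
  · calc Γ = Bᵀ * (Q * thermal (μ * κ * μ) * Qᵀ) * B := by
          rw [show μ * κ * μ = 1 by rw [mul_right_comm, hμμ, hinv], thermal_one, Matrix.mul_one, hQ,
            Matrix.mul_one, hB]
      _ = Bᵀ * Q * thermal μ * thermal κ * (Bᵀ * Q * thermal μ)ᵀ := by
          simp only [transpose_mul, transpose_transpose, thermal_transpose, Matrix.mul_assoc,
            ← thermal_mul]

/-! ### Variational characterization of the symplectic trace. -/

/-- The thermal form minimizes the trace over its symplectic orbit. -/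
theorem IsSymplectic.two_mul_sum_le_trace {S : PhaseMatrix N} (hS : IsSymplectic S)
    {ν : Fin N → ℝ} (hν : ∀ k, 0 ≤ ν k) : 2 * ∑ k, ν k ≤ (S * thermal ν * Sᵀ).trace := by
  have hT : (S * thermal ν * Sᵀ).trace = ∑ k, ν k * ∑ j, (S j (0, k) ^ 2 + S j (1, k) ^ 2) := by
    have hdiag (j) : (S * thermal ν * Sᵀ) j j = ∑ k, ν k * (S j (0, k) ^ 2 + S j (1, k) ^ 2) := by
      rw [mul_apply, Fintype.sum_prod_type_right]
      refine Finset.sum_congr rfl fun k _ => ?_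
      simp only [thermal_eq_diagonal, mul_diagonal, transpose_apply, Fin.sum_univ_two]
      ring
    simp only [trace, diag_apply, hdiag, Finset.mul_sum]
    exact Finset.sum_comm
  rw [hT, Finset.mul_sum]
  refine Finset.sum_le_sum fun k _ => ?_
  rw [mul_comm]
  refine mul_le_mul_of_nonneg_left ?_ (hν k)
  -- This entry of Sᵀ Ω S = Ω says that columns (0, k) and (1, k) have symplectic product 1; by 2xy
  -- ≤ x² + y² their squared norms then add up to at least 2.
  have h := congrFun (congrFun hS.transpose (0, k)) (1, k)
  rw [transpose_transpose, Matrix.mul_assoc, mul_apply] at h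
  have hΩ0 (l j) : (Omega N * S) (0, l) j = S (1, l) j := mulVec_Omega_zero (fun i => S i j) l
  have hΩ1 (l j) : (Omega N * S) (1, l) j = -S (0, l) j := mulVec_Omega_one (fun i => S i j) l
  have hΩ : Omega N (0, k) (1, k) = 1 := by simp [Omega]
  rw [hΩ, Fintype.sum_prod_type_right] at h
  simp only [transpose_apply, Fin.sum_univ_two, hΩ0, hΩ1] at h
  calc (2 : ℝ) = ∑ l, 2 * (S (0, l) (0, k) * S (1, l) (1, k) +
        S (1, l) (0, k) * -S (0, l) (1, k)) := by rw [← Finset.mul_sum, h, mul_one]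
    _ ≤ ∑ j, (S j (0, k) ^ 2 + S j (1, k) ^ 2) := by
      rw [Fintype.sum_prod_type_right]
      refine Finset.sum_le_sum fun l _ => ?_
      rw [Fin.sum_univ_two]
      nlinarith [sq_nonneg (S (0, l) (0, k) - S (1, l) (1, k)),
        sq_nonneg (S (1, l) (0, k) + S (0, l) (1, k))]

theorem trace_thermal (ν : Fin N → ℝ) : (thermal ν).trace = 2 * ∑ k, ν k := by
  rw [thermal_eq_diagonal, trace_diagonal, Fintype.sum_prod_type, Fin.sum_univ_two, two_mul]

theorem IsSymplecticSpectrum.two_mul_sum_le_trace {Γ : PhaseMatrix N} {ν : Fin N → ℝ}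
    (h : IsSymplecticSpectrum Γ ν) {S : PhaseMatrix N} (hS : IsSymplectic S) :
    2 * ∑ k, ν k ≤ (S * Γ * Sᵀ).trace := by
  obtain ⟨hν, T, hT, rfl⟩ := h
  have := (hS.mul hT).two_mul_sum_le_trace fun k => (hν k).le
  rw [transpose_mul] at this
  simpa only [Matrix.mul_assoc] using this

theorem IsSymplecticSpectrum.exists_trace_eq {Γ : PhaseMatrix N} {ν : Fin N → ℝ}
    (h : IsSymplecticSpectrum Γ ν) :
    ∃ S : PhaseMatrix N, IsSymplectic S ∧ (S * Γ * Sᵀ).trace = 2 * ∑ k, ν k := by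
  obtain ⟨hν, T, hT, rfl⟩ := h
  obtain ⟨S, hS, hST⟩ := hT.exists_left_inverse
  refine ⟨S, hS, ?_⟩
  rw [show S * (T * thermal ν * Tᵀ) * Sᵀ = (S * T) * thermal ν * (S * T)ᵀ by
    simp only [transpose_mul, Matrix.mul_assoc], hST, transpose_one, Matrix.one_mul,
    Matrix.mul_one, trace_thermal]

theorem isSymplecticSpectrum_symplecticEigenvalues {Γ : PhaseMatrix N} (hΓ : Γ.PosDef) :
    IsSymplecticSpectrum Γ (symplecticEigenvalues Γ) := by
  have h := exists_isSymplecticSpectrum hΓ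
  rw [symplecticEigenvalues, dif_pos h]
  exact h.choose_spec

/-- Both sums are the minimum of the same functional S ↦ Tr[S Γ Sᵀ], so they agree without comparing
the spectra entrywise. -/
theorem Str_eq {Γ : PhaseMatrix N} (hΓ : Γ.PosDef) {ν : Fin N → ℝ}
    (h : IsSymplecticSpectrum Γ ν) : Str Γ = 2 * ∑ k, ν k := by
  have h0 := isSymplecticSpectrum_symplecticEigenvalues hΓ
  obtain ⟨S, hS, hSt⟩ := h.exists_trace_eq
  obtain ⟨T, hT, hTt⟩ := h0.exists_trace_eq
  exact le_antisymm (hSt ▸ h0.two_mul_sum_le_trace hS) ((h.two_mul_sum_le_trace hT).trans_eq hTt)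

theorem Str_le_trace {Γ : PhaseMatrix N} (hΓ : Γ.PosDef) {S : PhaseMatrix N}
    (hS : IsSymplectic S) : Str Γ ≤ (S * Γ * Sᵀ).trace :=
  (isSymplecticSpectrum_symplecticEigenvalues hΓ).two_mul_sum_le_trace hS

theorem exists_trace_eq_Str {Γ : PhaseMatrix N} (hΓ : Γ.PosDef) :
    ∃ S : PhaseMatrix N, IsSymplectic S ∧ (S * Γ * Sᵀ).trace = Str Γ :=
  (isSymplecticSpectrum_symplecticEigenvalues hΓ).exists_trace_eq

/-- A minimizer for C + D is a competitor for C and for D. -/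
theorem Str_add_le {C D : PhaseMatrix N} (hC : C.PosDef) (hD : D.PosDef) :
    Str C + Str D ≤ Str (C + D) := by
  obtain ⟨S, hS, hSt⟩ := exists_trace_eq_Str (hC.add hD)
  rw [← hSt, Matrix.mul_add, Matrix.add_mul, trace_add]
  exact add_le_add (Str_le_trace hC hS) (Str_le_trace hD hS)

/-- The same argument with weights; it is done directly because a term with weight zero need not be
positive definite. -/
theorem le_Str_combination {C D : PhaseMatrix N} (hC : C.PosDef) (hD : D.PosDef) {a b : ℝ}
    (ha : 0 ≤ a) (hb : 0 ≤ b) (h : (a • C + b • D).PosDef) :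
    a * Str C + b * Str D ≤ Str (a • C + b • D) := by
  obtain ⟨S, hS, hSt⟩ := exists_trace_eq_Str h
  rw [← hSt, Matrix.mul_add, Matrix.add_mul, trace_add, Matrix.mul_smul, Matrix.smul_mul,
    Matrix.mul_smul, Matrix.smul_mul, trace_smul, trace_smul, smul_eq_mul, smul_eq_mul]
  exact add_le_add (mul_le_mul_of_nonneg_left (Str_le_trace hC hS) ha)
    (mul_le_mul_of_nonneg_left (Str_le_trace hD hS) hb)

/-! ### Extractable work. -/

/-- Z_r O is symplectic, which gives the upper bound. Conversely Tr[S Γ Sᵀ] depends only on Sᵀ S, so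
the Euler factors of a minimizing S attain it. -/
theorem isGreatest_workValues {Γ : PhaseMatrix N} (hΓ : Γ.PosDef) :
    IsGreatest (workValues Γ) (1 / 2 * (Γ.trace - Str Γ)) := by
  constructor
  · obtain ⟨S, hS, hSt⟩ := exists_trace_eq_Str hΓ
    obtain ⟨O, r, hO, hr⟩ := hS.exists_euler
    refine ⟨O, r, hO, ?_⟩
    rw [extractedWork, trace_sub, ← hSt]
    congr 2
    calc (S * Γ * Sᵀ).trace = (Oᵀ * (squeezer r * squeezer r * O * Γ)).trace := by
          rw [trace_mul_comm, ← Matrix.mul_assoc, hr]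
          simp only [Matrix.mul_assoc]
      _ = (squeezer r * (squeezer r * (O * Γ * Oᵀ))).trace := by
          rw [trace_mul_comm]
          simp only [Matrix.mul_assoc]
      _ = (squeezer r * (O * Γ * Oᵀ) * squeezer r).trace := trace_mul_comm _ _
  · rintro _ ⟨O, r, hO, rfl⟩
    have := Str_le_trace hΓ ((isSymplectic_squeezer r).mul hO.2)
    rw [show squeezer r * O * Γ * (squeezer r * O)ᵀ = squeezer r * (O * Γ * Oᵀ) * squeezer r by
      simp only [transpose_mul, squeezer_transpose, Matrix.mul_assoc]] at this
    rw [extractedWork, trace_sub]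
    linarith

theorem localWork_eq {Γ : PhaseMatrix N} (hΓ : Γ.PosDef) :
    localWork Γ = 1 / 2 * (Γ.trace - Str Γ) :=
  (isGreatest_workValues hΓ).csSup_eq

/-! ### Covariance matrices and convexity. -/

/-- The uncertainty relation in terms of real quadratic forms. -/
theorem isCovariance_iff {Γ : PhaseMatrix N} : IsCovariance Γ ↔
    Γ.PosDef ∧ ∀ x y, x ⬝ᵥ Omega N *ᵥ y ≤ x ⬝ᵥ Γ *ᵥ x + y ⬝ᵥ Γ *ᵥ y := by
  refine and_congr_right fun hΓ => ?_
  have hΓT : Γᵀ = Γ := hΓ.isHermitian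
  set M := Γ.map (fun x : ℝ => (x : ℂ)) +
      (Complex.I / 2) • (Omega N).map (fun x : ℝ => (x : ℂ)) with hM
  have hH : M.IsHermitian := by
    ext i j
    have h1 : Γ j i = Γ i j := congrFun (congrFun hΓT i) j
    have h2 : Omega N j i = -Omega N i j := congrFun (congrFun Omega_transpose i) j
    simp [hM, conjTranspose_apply, h1, h2, neg_div]
  have key : ∀ x y : Fin 2 × Fin N → ℝ,
      star (fun i => (x i : ℂ) + y i * Complex.I) ⬝ᵥ M *ᵥ (fun i => (x i : ℂ) + y i * Complex.I) =
        ((x ⬝ᵥ Γ *ᵥ x + y ⬝ᵥ Γ *ᵥ y - x ⬝ᵥ Omega N *ᵥ y : ℝ) : ℂ) := by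
    intro x y
    have e1 : x ⬝ᵥ Γ *ᵥ y = y ⬝ᵥ Γ *ᵥ x := by
      rw [dotProduct_mulVec, ← mulVec_transpose, hΓT, dotProduct_comm]
    have e2 : y ⬝ᵥ Omega N *ᵥ x = -(x ⬝ᵥ Omega N *ᵥ y) := by
      rw [dotProduct_mulVec, ← mulVec_transpose, Omega_transpose, neg_mulVec, neg_dotProduct,
        dotProduct_comm]
    have e3 : ∀ v, v ⬝ᵥ Omega N *ᵥ v = 0 := by
      intro v
      have : v ⬝ᵥ Omega N *ᵥ v = -(v ⬝ᵥ Omega N *ᵥ v) := by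
        conv_lhs => rw [dotProduct_mulVec, ← mulVec_transpose, Omega_transpose, neg_mulVec,
          neg_dotProduct, dotProduct_comm]
      linarith
    -- Bare expansion of the form at x + iy; symmetry of Γ and skewness of Ω then remove the
    -- imaginary part and merge the two mixed Ω terms.
    have e : star (fun i => (x i : ℂ) + y i * Complex.I) ⬝ᵥ
        M *ᵥ (fun i => (x i : ℂ) + y i * Complex.I) =
        ((x ⬝ᵥ Γ *ᵥ x + y ⬝ᵥ Γ *ᵥ y : ℝ) : ℂ) +
        Complex.I * ((x ⬝ᵥ Γ *ᵥ y - y ⬝ᵥ Γ *ᵥ x : ℝ) : ℂ) +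
        Complex.I / 2 * ((x ⬝ᵥ Omega N *ᵥ x + y ⬝ᵥ Omega N *ᵥ y : ℝ) : ℂ) -
        1 / 2 * ((x ⬝ᵥ Omega N *ᵥ y - y ⬝ᵥ Omega N *ᵥ x : ℝ) : ℂ) := by
      simp only [dotProduct, mulVec, hM, Complex.ofReal_add, Complex.ofReal_sub, Complex.ofReal_sum,
        Complex.ofReal_mul, Finset.mul_sum, ← Finset.sum_add_distrib, ← Finset.sum_sub_distrib]
      refine Finset.sum_congr rfl fun i _ => Finset.sum_congr rfl fun j _ => ?_
      simp only [Pi.star_apply, star_add, star_mul', Complex.star_def, Complex.conj_ofReal,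
        Complex.conj_I, Matrix.add_apply, Matrix.smul_apply, map_apply, smul_eq_mul]
      ring_nf
      simp only [Complex.I_sq, Complex.I_pow_three]
      ring
    rw [e, e1, e2, e3, e3]
    push_cast
    ring
  rw [posSemidef_iff_dotProduct_mulVec, and_iff_right hH]
  constructor
  · intro h x y
    have := h fun i => (x i : ℂ) + y i * Complex.I
    rw [key, Complex.zero_le_real] at this
    linarith
  · intro h z
    have := h (fun i => (z i).re) (fun i => (z i).im)
    have hz : z = fun i => ((z i).re : ℂ) + (z i).im * Complex.I :=
      funext fun i => (Complex.re_add_im _).symm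
    rw [hz, key, Complex.zero_le_real]
    linarith

theorem convex_isCovariance : Convex ℝ {Γ : PhaseMatrix N | IsCovariance Γ} := by
  intro C hC D hD a b ha hb hab
  rw [Set.mem_ofPred_eq, isCovariance_iff] at *
  refine ⟨?_, fun x y => ?_⟩
  -- Strict positivity needs a nonzero weight on a positive definite term.
  · rcases ha.eq_or_lt with rfl | ha'
    · obtain rfl : b = 1 := by linarith
      simpa using hD.1
    · exact (hC.1.smul ha').add_posSemidef (hD.1.posSemidef.smul hb)
  · have h1 := mul_le_mul_of_nonneg_left (hC.2 x y) ha
    have h2 := mul_le_mul_of_nonneg_left (hD.2 x y) hb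
    simp only [add_mulVec, smul_mulVec, dotProduct_add, dotProduct_smul, smul_eq_mul]
    have : x ⬝ᵥ Omega N *ᵥ y = a * (x ⬝ᵥ Omega N *ᵥ y) + b * (x ⬝ᵥ Omega N *ᵥ y) := by
      rw [← add_mul, hab, one_mul]
    linarith

theorem convexOn_localWork : ConvexOn ℝ {Γ : PhaseMatrix N | IsCovariance Γ} localWork := by
  refine ⟨convex_isCovariance, fun C hC D hD a b ha hb hab => ?_⟩
  have h : IsCovariance (a • C + b • D) := convex_isCovariance hC hD ha hb hab
  rw [localWork_eq h.1, localWork_eq hC.1, localWork_eq hD.1]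
  have := le_Str_combination hC.1 hD.1 ha hb h.1
  simp only [trace_add, trace_smul, smul_eq_mul]
  linarith

/-! ### Free covariance matrices as those commuting with Ω. -/

theorem IsFreeCovariance.mul_Omega {Γ : PhaseMatrix N} (h : IsFreeCovariance Γ) :
    Γ * Omega N = Omega N * Γ := by
  obtain ⟨O, ν, hO, hν, rfl⟩ := h
  rw [Matrix.mul_assoc, hO.transpose.mul_Omega, ← Matrix.mul_assoc, Matrix.mul_assoc O,
    ← Omega_mul_thermal, ← Matrix.mul_assoc, hO.mul_Omega]
  simp only [Matrix.mul_assoc]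

theorem IsFreeCovariance.isCovariance {Γ : PhaseMatrix N} (h : IsFreeCovariance Γ) :
    IsCovariance Γ := by
  obtain ⟨O, ν, hO, hν, rfl⟩ := h
  rw [isCovariance_iff]
  constructor
  · rw [← conjTranspose_eq_transpose_of_trivial]
    refine PosDef.mul_mul_conjTranspose_same ?_ ?_
    · rw [thermal_eq_diagonal]
      exact PosDef.diagonal fun i => by linarith [hν i.2]
    · exact vecMul_injective_of_isUnit (IsUnit.of_mul_eq_one _ hO.1)
  · have hΩ : Omega N = O * Omega N * Oᵀ := hO.2.symm
    have key (M : PhaseMatrix N) (x y) :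
        x ⬝ᵥ (O * M * Oᵀ) *ᵥ y = (Oᵀ *ᵥ x) ⬝ᵥ M *ᵥ (Oᵀ *ᵥ y) := by
      rw [← mulVec_mulVec, ← mulVec_mulVec, dotProduct_mulVec, ← mulVec_transpose]
    intro x y
    rw [hΩ, key, key, key]
    generalize Oᵀ *ᵥ x = x
    generalize Oᵀ *ᵥ y = y
    simp only [dotProduct, Fintype.sum_prod_type_right, Fin.sum_univ_two, mulVec_Omega_zero,
      mulVec_Omega_one, ← Finset.sum_add_distrib, thermal_eq_diagonal, mulVec_diagonal]
    refine Finset.sum_le_sum fun k _ => ?_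
    have h1 := mul_nonneg (sub_nonneg.2 (hν k)) (sq_nonneg (x (0, k)))
    have h2 := mul_nonneg (sub_nonneg.2 (hν k)) (sq_nonneg (x (1, k)))
    have h3 := mul_nonneg (sub_nonneg.2 (hν k)) (sq_nonneg (y (0, k)))
    have h4 := mul_nonneg (sub_nonneg.2 (hν k)) (sq_nonneg (y (1, k)))
    -- In each mode ν ≥ ½ reduces the claim to ν = ½, where the difference is half the sum of these
    -- two squares.
    linarith [sq_nonneg (x (0, k) - y (1, k)), sq_nonneg (x (1, k) + y (0, k))]

/-- Ω preserves each eigenspace of Γ, so a passive matrix diagonalizes Γ; the diagonal commutes with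
Ω too, hence is constant on each mode. -/
theorem IsCovariance.isFreeCovariance {Γ : PhaseMatrix N} (h : IsCovariance Γ)
    (hΩ : Γ * Omega N = Omega N * Γ) : IsFreeCovariance Γ := by
  rw [isCovariance_iff] at h
  obtain ⟨O, a, hO, ha⟩ := exists_passive_diagonalization (P := Γ)
    h.1.isHermitian
    (fun v c hv => ⟨c, by rw [mulVec_mulVec, hΩ, ← mulVec_mulVec, hv, mulVec_smul]⟩)
  have hD : diagonal a = Oᵀ * Γ * O := by
    rw [ha]
    calc diagonal a = (Oᵀ * O) * diagonal a * (Oᵀ * O) := by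
          rw [hO.transpose_mul_self, Matrix.one_mul, Matrix.mul_one]
      _ = Oᵀ * (O * diagonal a * Oᵀ) * O := by simp only [Matrix.mul_assoc]
  have hDΩ : diagonal a * Omega N = Omega N * diagonal a := by
    rw [hD, Matrix.mul_assoc, hO.mul_Omega, ← Matrix.mul_assoc, Matrix.mul_assoc Oᵀ, hΩ,
      ← Matrix.mul_assoc, hO.transpose.mul_Omega]
    simp only [Matrix.mul_assoc]
  have ha1 : ∀ k, a (1, k) = a (0, k) := by
    intro k
    have := congrFun (congrFun hDΩ (0, k)) (1, k)
    simpa [diagonal_mul, mul_diagonal, Omega] using this.symm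
  have hat : diagonal a = thermal fun k => a (0, k) := by
    rw [thermal_eq_diagonal]
    congr 1
    ext ⟨i, k⟩
    fin_cases i
    · rfl
    · exact ha1 k
  refine ⟨O, fun k => a (0, k), hO, fun k => ?_, by rw [← hat, ha]⟩
  have key (M : PhaseMatrix N) (i j) :
      (O *ᵥ Pi.single i 1) ⬝ᵥ M *ᵥ (O *ᵥ Pi.single j 1) = (Oᵀ * M * O) i j := by
    rw [← vecMul_transpose, ← dotProduct_mulVec, mulVec_mulVec, mulVec_mulVec, Matrix.mul_assoc]
    simp
  -- On columns (0, k) and (1, k) of O the uncertainty relation reads 1 ≤ 2ν.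
  have h2 := h.2 (O *ᵥ Pi.single (0, k) 1) (O *ᵥ Pi.single (1, k) 1)
  have hΩ' : Oᵀ * Omega N * O = Omega N := by simpa [IsSymplectic] using hO.2.transpose
  rw [key, key, key, hΩ', ← hD, diagonal_apply_eq, diagonal_apply_eq, ha1] at h2
  have : Omega N (0, k) (1, k) = 1 := by simp [Omega]
  linarith

/-- The passive form is already a Williamson form, and O preserves the trace. -/
theorem IsFreeCovariance.localWork_eq_zero {Γ : PhaseMatrix N} (h : IsFreeCovariance Γ) :
    localWork Γ = 0 := by
  have hΓ := h.isCovariance.1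
  obtain ⟨O, ν, hO, hν, rfl⟩ := h
  rw [localWork_eq hΓ, Str_eq hΓ ⟨fun k => by linarith [hν k], O, hO.2, rfl⟩, trace_mul_comm,
    ← Matrix.mul_assoc, hO.transpose_mul_self, Matrix.one_mul, trace_thermal, sub_self, mul_zero]

end GaussianWork

theorem mainTheorem4 (N : ℕ) :
    -- the symplectic trace of a positive definite matrix is well defined
    (∀ Γ : PhaseMatrix N, Γ.PosDef →
      IsSymplecticSpectrum Γ (symplecticEigenvalues Γ) ∧
        ∀ ν : Fin N → ℝ, IsSymplecticSpectrum Γ ν → Str Γ = 2 * ∑ k, ν k) ∧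
    -- the symplectic trace is superadditive
    (∀ C D : PhaseMatrix N, C.PosDef → D.PosDef → Str C + Str D ≤ Str (C + D)) ∧
    -- the maximum that defines the local extractable work is attained, and its value
    (∀ Γ : PhaseMatrix N, IsCovariance Γ →
      IsGreatest (workValues Γ) (localWork Γ) ∧
        localWork Γ = 1 / 2 * (Γ.trace - Str Γ)) ∧
    -- the local extractable work is a convex function of the covariance matrix
    ConvexOn ℝ {Γ : PhaseMatrix N | IsCovariance Γ} localWork ∧
    (∀ (m : ℕ) (p : Fin m → ℝ) (Γ : Fin m → PhaseMatrix N),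
      (∀ j, 0 ≤ p j) → ∑ j, p j = 1 → (∀ j, IsCovariance (Γ j)) →
      IsCovariance (∑ j, p j • Γ j) ∧
        localWork (∑ j, p j • Γ j) ≤ ∑ j, p j * localWork (Γ j)) ∧
    -- mixtures of free covariance matrices have no extractable work, and are free
    (∀ (m : ℕ) (p : Fin m → ℝ) (Γ : Fin m → PhaseMatrix N),
      (∀ j, 0 ≤ p j) → ∑ j, p j = 1 → (∀ j, IsFreeCovariance (Γ j)) →
      IsCovariance (∑ j, p j • Γ j) ∧
        localWork (∑ j, p j • Γ j) = 0 ∧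
        IsFreeCovariance (∑ j, p j • Γ j)) := by

  refine ⟨fun Γ hΓ => ⟨isSymplecticSpectrum_symplecticEigenvalues hΓ, fun ν h => Str_eq hΓ h⟩,
    fun C D hC hD => Str_add_le hC hD,
    fun Γ hΓ => ⟨localWork_eq hΓ.1 ▸ isGreatest_workValues hΓ.1, localWork_eq hΓ.1⟩,
    convexOn_localWork, fun m p Γ hp hp1 hΓ => ?_, fun m p Γ hp hp1 hΓ => ?_⟩
  · exact ⟨convex_isCovariance.sum_mem (fun j _ => hp j) hp1 fun j _ => hΓ j,
      convexOn_localWork.map_sum_le (fun j _ => hp j) hp1 fun j _ => hΓ j⟩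
  · have hcov : IsCovariance (∑ j, p j • Γ j) :=
      convex_isCovariance.sum_mem (fun j _ => hp j) hp1 fun j _ => (hΓ j).isCovariance
    have hfree : IsFreeCovariance (∑ j, p j • Γ j) := by
      -- Different Γ j may need different O; commutation with Ω avoids any common diagonalization.
      refine hcov.isFreeCovariance ?_
      simp only [Matrix.sum_mul, Matrix.mul_sum, Matrix.smul_mul, Matrix.mul_smul,
        (hΓ _).mul_Omega]
    exact ⟨hcov, hfree.localWork_eq_zero, hfree⟩
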